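/- Let $\mathcal{X}$ be a set, let $a \le 0 < b$ be real numbers, and let $\mathcal{F}$ be a class of functions $\mathcal{X} \to [a,b]$ that contains the zero function. Let $n, m \ge 1$, let $\mathcal{S} = (s_1,\dots,s_m)$ be a fixed sample of elements of $\mathcal{X}$, and let $\boldsymbol\sigma = (\boldsymbol\sigma_{j,i})_{1\le j\le n,\,1\le i\le m}$ be a matrix of independent random variables, each equal to $1$ or $-1$ with probability $1/2$. Define the $n$-Monte Carlo empirical Rademacher average (MCERA) and the empirical Rademacher average (ERA) $$\hat R^n_m(\mathcal{F},\mathcal{S},\boldsymbol\sigma) = \frac1n\sum_{j=1}^n \sup_{f\in\mathcal{F}} \frac1m \sum_{i=1}^m \boldsymbol\sigma_{j,i} f(s_i), \qquad \hat R(\mathcal{F},\mathcal{S}) = \mathbb{E}_{\boldsymbol\sigma}\left[\hat R^n_m(\mathcal{F},\mathcal{S},\boldsymbol\sigma)\right],$$ and the empirical quantities $$\hat z = \sup_{1\le i\le m,\, f\in\mathcal{F}} |f(s_i)|, \qquad \hat\nu = \frac1m \sup_{f\in\mathcal{F}} \sum_{i=1}^m |f(s_i)|, \qquad \hat\sigma^2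 = \frac1m \sup_{f\in\mathcal{F}} \sum_{i=1}^m f(s_i)^2 .$$ Let $\delta \in (0,1]$. Then, with probability at least $1-\delta$ over $\boldsymbol\sigma$, $$\hat R(\mathcal{F},\mathcal{S}) \le \hat R^n_m(\mathcal{F},\mathcal{S},\boldsymbol\sigma) + \frac{2\hat z\ln(1/\delta)}{nm} + \sqrt{\left(\frac{2\hat z\ln(1/\delta)}{nm}\right)^2 + \frac{4\hat z\left(\hat R^n_m(\mathcal{F},\mathcal{S},\boldsymbol\sigma)+\hat\nu\right)\ln(1/\delta)}{nm}} .$$ Also, with probability at least $1-\delta$ over $\boldsymbol\sigma$, $$\hat R(\mathcal{F},\mathcal{S}) \le \hat R^n_m(\mathcal{F},\mathcal{S},\boldsymbol\sigma) + \frac{2\hat z\ln(1/\delta)}{nm} + \sqrt{\left(\frac{2\hat z\ln(1/\delta)}{nm}\right)^2 + \frac{4\left(\hat z\,\hat R^n_m(\mathcal{F},\mathcal{S},\boldsymbol\sigma)+\hat\sigma^2\right)\ln(1/\delta)}{nm}} .$$ -/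

import Mathlib

open MeasureTheory ProbabilityTheory

noncomputable section

/-- The `n`-Monte Carlo empirical Rademacher average of the class `F` on the sample `s` for the
`n × m` sign matrix `σ`. -/
def mcera {X : Type*} {n m : ℕ} (F : Set (X → ℝ)) (s : Fin m → X)
    (σ : Fin n → Fin m → ℝ) : ℝ :=
  (1 / (n : ℝ)) * ∑ j, ⨆ f : F, (1 / (m : ℝ)) * ∑ i, σ j i * (f : X → ℝ) (s i)

/-- `σ` is an `n × m` matrix of independent random signs, each equal to `1` or `-1` with
probability one half. -/
structure IsRademacherMatrix {Ω : Type*} [MeasurableSpace Ω] {n m : ℕ}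
    (σ : Fin n → Fin m → Ω → ℝ) (P : Measure Ω) : Prop where
  measurable : ∀ j i, Measurable (σ j i)
  indep : iIndepFun (fun (p : Fin n × Fin m) (ω : Ω) => σ p.1 p.2 ω) P
  prob_one : ∀ j i, P {ω | σ j i ω = 1} = 1 / 2
  prob_neg_one : ∀ j i, P {ω | σ j i ω = -1} = 1 / 2

/-- The empirical Rademacher average of `F` on the (fixed) sample `s`: the expectation of the
`n`-Monte Carlo empirical Rademacher average over the random sign matrix `σ`. -/
def era {X Ω : Type*} [MeasurableSpace Ω] {n m : ℕ} (F : Set (X → ℝ)) (s : Fin m → X)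
    (σ : Fin n → Fin m → Ω → ℝ) (P : Measure Ω) : ℝ :=
  ∫ ω, mcera F s (fun j i => σ j i ω) ∂P

/-- The empirical sup-norm `ẑ` of `F` on the sample. -/
def empSup {X : Type*} {m : ℕ} (F : Set (X → ℝ)) (s : Fin m → X) : ℝ :=
  ⨆ p : Fin m × F, |(p.2 : X → ℝ) (s p.1)|

/-- The supremum mean absolute value `ν̂` of `F` on the sample. -/
def empAbs {X : Type*} {m : ℕ} (F : Set (X → ℝ)) (s : Fin m → X) : ℝ :=
  (1 / (m : ℝ)) * ⨆ f : F, ∑ i, |(f : X → ℝ) (s i)|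

/-- The empirical wimpy variance `σ̂²` of `F` on the sample. -/
def empWimpyVar {X : Type*} {m : ℕ} (F : Set (X → ℝ)) (s : Fin m → X) : ℝ :=
  (1 / (m : ℝ)) * ⨆ f : F, ∑ i, (f : X → ℝ) (s i) ^ 2

end

/-! View the MCERA as a function `Y` on the cube of `n * m` signs with uniform measure, and let R be
its mean, the ERA. Write ζ = ẑ/(nm) and v = σ̂²/(nm). Flipping one sign lowers `Y` by at most 2ζ,
and the squared decreases over all flips sum to at most 4v, because one near-optimal function per
row controls every flip in that row (`sum_max_mcera_sub_sq_le`).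

Tensorization (`entropy_le_expect_sum_twoPointEntropy`) and a two-point estimate bound the entropy
of exp(-lY). Herbst's argument (`expect_exp_neg_le`) turns this into a Laplace transform bound with
exponent -lR + l²v·exp(2lζ). For a deviation T ≤ R, the factor exp(2lζ) costs no more than replacing
v by ζR + v (`exists_chernoff_bound`). So with probability at least 1 - δ the MCERA is at least R -
√(4(ζR + v) ln(1/δ)). Solving this quadratic inequality for R gives the σ̂² bound; σ̂² ≤ ẑν̂ then
gives the ν̂ bound. -/

open scoped BigOperators

/-! ### Two-point entropy -/

/-- The entropy of a function taking the values `a` and `b` with probability one half each. -/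
noncomputable def twoPointEntropy (a b : ℝ) : ℝ :=
  (a * Real.log a + b * Real.log b) / 2 - (a + b) / 2 * Real.log ((a + b) / 2)

theorem twoPointEntropy_comm (a b : ℝ) : twoPointEntropy a b = twoPointEntropy b a := by
  unfold twoPointEntropy
  rw [add_comm a b, add_comm (a * _)]

/-- Duality formula for the two-point entropy. -/
theorem le_twoPointEntropy {a b A B : ℝ} (ha : 0 < a) (hb : 0 < b) (hA : 0 < A) (hB : 0 < B) :
    a * ((Real.log A - Real.log ((A + B) / 2)) / 2)
      + b * ((Real.log B - Real.log ((A + B) / 2)) / 2) ≤ twoPointEntropy a b := by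
  have key : ∀ x y : ℝ, 0 < x → 0 < y →
      x - (a + b) * y / (A + B) ≤
        x * (Real.log x - Real.log ((a + b) / 2) + Real.log ((A + B) / 2) - Real.log y) := by
    intro x y hx hy
    -- log t ≥ 1 - 1/t; the resulting lower bounds at the two points sum to zero.
    have h := Real.one_sub_inv_le_log_of_pos
      (show 0 < x / ((a + b) / 2) * (((A + B) / 2) / y) by positivity)
    rw [Real.log_mul (by positivity) (by positivity),
      Real.log_div (y := (a + b) / 2) (by positivity) (by positivity),
      Real.log_div (y := y) (by positivity) (by positivity)] at h
    have h2 := mul_le_mul_of_nonneg_left h hx.le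
    have h3 : x * (1 - (x / ((a + b) / 2) * (((A + B) / 2) / y))⁻¹) =
        x - (a + b) * y / (A + B) := by
      field_simp
    rw [h3] at h2
    linarith
  have h1 := key a A ha hA
  have h2 := key b B hb hB
  have h3 : (a + b) * A / (A + B) + (a + b) * B / (A + B) = a + b := by
    field_simp
  unfold twoPointEntropy
  linarith

/-- Joint convexity of the two-point entropy. -/
theorem twoPointEntropy_expect_le {κ : Type*} [Fintype κ] [Nonempty κ] {f g : κ → ℝ}
    (hf : ∀ k, 0 < f k) (hg : ∀ k, 0 < g k) :
    twoPointEntropy (𝔼 k, f k) (𝔼 k, g k) ≤ 𝔼 k, twoPointEntropy (f k) (g k) := by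
  have hA : 0 < 𝔼 k, f k := Finset.expect_pos (fun k _ => hf k) Finset.univ_nonempty
  have hB : 0 < 𝔼 k, g k := Finset.expect_pos (fun k _ => hg k) Finset.univ_nonempty
  -- Entropy is a supremum of linear functionals; the one given by the averages is exact at the
  -- averages.
  have h : 𝔼 k, _ ≤ 𝔼 k, twoPointEntropy (f k) (g k) :=
    Finset.expect_le_expect fun k _ => le_twoPointEntropy (hf k) (hg k) hA hB
  rw [Finset.expect_add_distrib, ← Finset.expect_mul, ← Finset.expect_mul] at h
  refine le_trans (le_of_eq ?_) h
  unfold twoPointEntropy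
  ring

/-! ### Sign flips and tensorization -/

/-- The sign vector with coordinate `i` flipped. -/
def flipAt {ι : Type*} [DecidableEq ι] (i : ι) (ε : ι → Bool) : ι → Bool :=
  Function.update ε i (!ε i)

theorem flipAt_flipAt {ι : Type*} [DecidableEq ι] (i : ι) (ε : ι → Bool) :
    flipAt i (flipAt i ε) = ε := by
  simp [flipAt]

theorem expect_flipAt {ι : Type*} [Fintype ι] [DecidableEq ι] (i : ι) (f : (ι → Bool) → ℝ) :
    𝔼 ε, f (flipAt i ε) = 𝔼 ε, f ε :=
  Fintype.expect_bijective (flipAt i) (Function.Involutive.bijective (flipAt_flipAt i)) _ _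
    fun _ => rfl

theorem expect_bool (f : Bool → ℝ) : 𝔼 b, f b = (f false + f true) / 2 := by
  rw [Fintype.expect_eq_sum_div_card]
  simp [add_comm]

theorem expect_option_cube {ι : Type*} [Fintype ι] [DecidableEq ι] [DecidableEq (Option ι)]
    (f : (Option ι → Bool) → ℝ) :
    𝔼 ε, f ε = (𝔼 ε : ι → Bool, f (Equiv.piOptionEquivProd.symm (false, ε))
      + 𝔼 ε : ι → Bool, f (Equiv.piOptionEquivProd.symm (true, ε))) / 2 := by
  rw [Fintype.expect_equiv Equiv.piOptionEquivProd f
    (fun p => f (Equiv.piOptionEquivProd.symm p))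
      fun ε => by rw [Equiv.symm_apply_apply], ← Finset.univ_product_univ,
    Finset.expect_product, expect_bool]

/-- Tensorization of entropy on the discrete cube. -/
theorem entropy_le_expect_sum_twoPointEntropy {ι : Type*} [Fintype ι] [DecidableEq ι]
    (g : (ι → Bool) → ℝ) (hg : ∀ ε, 0 < g ε) :
    𝔼 ε, g ε * Real.log (g ε) - (𝔼 ε, g ε) * Real.log (𝔼 ε, g ε)
      ≤ 𝔼 ε, ∑ i, twoPointEntropy (g ε) (g (flipAt i ε)) := by
  revert g
  -- The decidability instance is generalized so that the induction over finite types can supply its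
  -- own.
  suffices H : ∀ [DecidableEq ι], ∀ g : (ι → Bool) → ℝ, (∀ ε, 0 < g ε) →
      𝔼 ε, g ε * Real.log (g ε) - (𝔼 ε, g ε) * Real.log (𝔼 ε, g ε)
      ≤ 𝔼 ε, ∑ i, twoPointEntropy (g ε) (g (flipAt i ε)) from H
  refine Fintype.induction_empty_option (P := fun (ι : Type _) [Fintype ι] =>
    ∀ [DecidableEq ι], ∀ g : (ι → Bool) → ℝ, (∀ ε, 0 < g ε) →
      𝔼 ε, g ε * Real.log (g ε) - (𝔼 ε, g ε) * Real.log (𝔼 ε, g ε)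
      ≤ 𝔼 ε, ∑ i, twoPointEntropy (g ε) (g (flipAt i ε))) ?_ ?_ ?_ ι
  · intro α β _ e ih _ g hg
    let _ : Fintype α := Fintype.ofEquiv β e.symm
    classical
    have h := ih (fun ε => g (ε ∘ e.symm)) (fun ε => hg _)
    have tr : ∀ F : (β → Bool) → ℝ, 𝔼 ε : α → Bool, F (ε ∘ e.symm) = 𝔼 ε, F ε := fun F =>
      Fintype.expect_equiv (e.arrowCongr (Equiv.refl Bool)) _ _ fun ε => rfl
    rw [tr (fun ε => g ε * Real.log (g ε)), tr g] at h
    refine h.trans (le_of_eq ?_)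
    rw [← tr]
    refine Finset.expect_congr rfl fun ε _ => ?_
    refine Fintype.sum_equiv e _ _ fun i => ?_
    congr 2
    funext j
    by_cases hj : j = e i
    · subst hj; simp [flipAt]
    · have : e.symm j ≠ i := fun h => hj (by simp [← h])
      simp [flipAt, hj, this]
  · intro _ g hg
    simp
  · intro α _ ih _ g hg
    classical
    have h0 := ih (fun ε => g (Equiv.piOptionEquivProd.symm (false, ε))) fun _ => hg _
    have h1 := ih (fun ε => g (Equiv.piOptionEquivProd.symm (true, ε))) fun _ => hg _
    have h2 := twoPointEntropy_expect_le
      (f := fun ε : α → Bool => g (Equiv.piOptionEquivProd.symm (false, ε)))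
      (g := fun ε => g (Equiv.piOptionEquivProd.symm (true, ε))) (fun _ => hg _) (fun _ => hg _)
    have hnone : ∀ (b : Bool) (ε : α → Bool),
        flipAt none (Equiv.piOptionEquivProd.symm (b, ε) : Option α → Bool)
          = Equiv.piOptionEquivProd.symm (!b, ε) := by
      intro b ε
      funext j
      cases j <;> simp [flipAt, Equiv.piOptionEquivProd]
    have hsome : ∀ (b : Bool) (i : α) (ε : α → Bool),
        flipAt (some i) (Equiv.piOptionEquivProd.symm (b, ε) : Option α → Bool)
          = Equiv.piOptionEquivProd.symm (b, flipAt i ε) := by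
      intro b i ε
      funext j
      cases j with
      | none => simp [flipAt, Equiv.piOptionEquivProd]
      | some j =>
        by_cases hj : j = i
        · subst hj; simp [flipAt, Equiv.piOptionEquivProd]
        · simp [flipAt, Equiv.piOptionEquivProd, hj]
    simp only [expect_option_cube, Fintype.sum_option, hnone, hsome, Finset.expect_add_distrib,
      Bool.not_false, Bool.not_true]
    simp only [twoPointEntropy_comm (g (Equiv.piOptionEquivProd.symm (true, _)))
      (g (Equiv.piOptionEquivProd.symm (false, _)))]
    -- Chain rule: the total entropy is the average of the two face entropies plus the two-point
    -- entropy of the face means, and joint convexity (`h2`) bounds the latter.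
    have h3 : ∀ x y : ℝ, (x + y) / 2 * Real.log ((x + y) / 2) =
        (x * Real.log x + y * Real.log y) / 2 - twoPointEntropy x y := by
      intro x y; unfold twoPointEntropy; ring
    rw [h3]
    linarith

/-! ### Entropy of negative exponentials -/

theorem twoPointEntropy_exp_neg_le (x y : ℝ) (hxy : y ≤ x) :
    twoPointEntropy (Real.exp (-x)) (Real.exp (-y)) ≤ (x - y) ^ 2 / 8 * Real.exp (-y) := by
  have hp : Real.exp (-x) = Real.exp (-x / 2) ^ 2 := by rw [← Real.exp_nat_mul]; ring_nf
  have hq : Real.exp (-y) = Real.exp (-y / 2) ^ 2 := by rw [← Real.exp_nat_mul]; ring_nf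
  have hpq : Real.exp (-(x + y) / 2) = Real.exp (-x / 2) * Real.exp (-y / 2) := by
    rw [← Real.exp_add]; ring_nf
  set M := (Real.exp (-x) + Real.exp (-y)) / 2 with hM
  have hMpos : 0 < M := by positivity
  have h := Real.one_sub_inv_le_log_of_pos (show 0 < M / Real.exp (-(x + y) / 2) by positivity)
  rw [Real.log_div hMpos.ne' (Real.exp_pos _).ne', Real.log_exp] at h
  have h2 := mul_le_mul_of_nonneg_left h hMpos.le
  have h3 : M * (1 - (M / Real.exp (-(x + y) / 2))⁻¹) = M - Real.exp (-(x + y) / 2) := by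
    field_simp
  rw [h3, hpq] at h2
  unfold twoPointEntropy
  rw [Real.log_exp, Real.log_exp, ← hM]
  have hle : Real.exp (-x / 2) ≤ Real.exp (-y / 2) := Real.exp_le_exp.2 (by linarith)
  rw [hp, hq] at hM ⊢
  set p := Real.exp (-x / 2)
  set q := Real.exp (-y / 2)
  rw [hM] at h2 ⊢
  have h5 : 0 ≤ (x - y) * (q - p) ^ 2 := mul_nonneg (by linarith) (sq_nonneg _)
  -- With d = x - y the entropy is at most d(q² - p²)/4 - (q - p)²/2; here q² - p² ≤ 2q(q - p), and
  -- AM-GM finishes.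
  nlinarith [sq_nonneg ((x - y) / 2 * q - (q - p))]

/-- Moving the weight from the larger exponential to the smaller costs a factor exp K. Each term
then pairs a decrease with the weight of the point it starts from, which is the form controllable
for a supremum. -/
theorem twoPointEntropy_exp_neg_le_of_sub_le {x y K : ℝ} (h : x - y ≤ K) (h' : y - x ≤ K) :
    twoPointEntropy (Real.exp (-x)) (Real.exp (-y)) ≤
      Real.exp K / 8 * (max (x - y) 0 ^ 2 * Real.exp (-x) + max (y - x) 0 ^ 2 * Real.exp (-y)) := by
  have key : ∀ x y : ℝ, x - y ≤ K → y ≤ x →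
      (x - y) ^ 2 / 8 * Real.exp (-y) ≤ Real.exp K / 8 * ((x - y) ^ 2 * Real.exp (-x)) := by
    intro x y h hxy
    have h1 : Real.exp (-y) ≤ Real.exp K * Real.exp (-x) := by
      rw [← Real.exp_add]; exact Real.exp_le_exp.2 (by linarith)
    calc _ ≤ (x - y) ^ 2 / 8 * (Real.exp K * Real.exp (-x)) := by gcongr
      _ = _ := by ring
  rcases le_total y x with hxy | hxy
  · rw [max_eq_left (by linarith), max_eq_right (by linarith)]
    have := (twoPointEntropy_exp_neg_le x y hxy).trans (key x y h hxy)
    simpa using this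
  · rw [max_eq_right (by linarith), max_eq_left (by linarith), twoPointEntropy_comm]
    have := (twoPointEntropy_exp_neg_le y x hxy).trans (key y x h' hxy)
    simpa using this

/-! ### Herbst's argument and the lower tail -/

section Cube

variable {ι : Type*} [Fintype ι] [DecidableEq ι] {Y : (ι → Bool) → ℝ} {v ζ : ℝ}

theorem entropy_exp_neg_le (hY : ∀ ε, ∑ i, max (Y ε - Y (flipAt i ε)) 0 ^ 2 ≤ 4 * v)
    (hζ : ∀ ε i, Y ε - Y (flipAt i ε) ≤ 2 * ζ) {l : ℝ} (hl : 0 ≤ l) :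
    𝔼 ε, Real.exp (-(l * Y ε)) * (-(l * Y ε))
      - (𝔼 ε, Real.exp (-(l * Y ε))) * Real.log (𝔼 ε, Real.exp (-(l * Y ε)))
      ≤ l ^ 2 * (v * Real.exp (2 * l * ζ)) * 𝔼 ε, Real.exp (-(l * Y ε)) := by
  have h := entropy_le_expect_sum_twoPointEntropy (fun ε => Real.exp (-(l * Y ε)))
    fun _ => Real.exp_pos _
  simp only [Real.log_exp] at h
  refine h.trans ?_
  set S : (ι → Bool) → ι → ℝ := fun ε i =>
    max (l * Y ε - l * Y (flipAt i ε)) 0 ^ 2 * Real.exp (-(l * Y ε)) with hS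
  have hmul : ∀ x y : ℝ, max (l * x - l * y) 0 = l * max (x - y) 0 := by
    intro x y
    rw [mul_max_of_nonneg _ _ hl, mul_zero, mul_sub]
  have hle : ∀ ε i, l * Y ε - l * Y (flipAt i ε) ≤ 2 * l * ζ := by
    intro ε i
    have := mul_le_mul_of_nonneg_left (hζ ε i) hl
    linarith
  have h1 : 𝔼 ε, ∑ i, twoPointEntropy (Real.exp (-(l * Y ε))) (Real.exp (-(l * Y (flipAt i ε))))
      ≤ 𝔼 ε, ∑ i, Real.exp (2 * l * ζ) / 8 * (S ε i + S (flipAt i ε) i) := by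
    refine Finset.expect_le_expect fun ε _ => Finset.sum_le_sum fun i _ => ?_
    have := twoPointEntropy_exp_neg_le_of_sub_le (hle ε i)
      (by simpa only [flipAt_flipAt] using hle (flipAt i ε) i)
    simpa only [hS, flipAt_flipAt] using this
  -- Flipping preserves the uniform measure, so both terms have equal mean and 1/8 becomes 1/4.
  have h2 : 𝔼 ε, ∑ i, Real.exp (2 * l * ζ) / 8 * (S ε i + S (flipAt i ε) i)
      = 𝔼 ε, Real.exp (2 * l * ζ) / 4 * ∑ i, S ε i := by
    simp only [← Finset.mul_sum, ← Finset.mul_expect, Finset.sum_add_distrib,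
      Finset.expect_add_distrib]
    have : 𝔼 ε, ∑ i, S (flipAt i ε) i = 𝔼 ε, ∑ i, S ε i := by
      rw [Finset.expect_sum_comm, Finset.expect_sum_comm]
      exact Finset.sum_congr rfl fun i _ => expect_flipAt i fun ε => S ε i
    rw [this]; ring
  refine h1.trans (h2.le.trans ?_)
  rw [Finset.mul_expect]
  refine Finset.expect_le_expect fun ε _ => ?_
  have h3 : ∑ i, S ε i = l ^ 2 * Real.exp (-(l * Y ε))
      * ∑ i, max (Y ε - Y (flipAt i ε)) 0 ^ 2 := by
    rw [Finset.mul_sum]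
    refine Finset.sum_congr rfl fun i _ => ?_
    simp only [hS, hmul]; ring
  rw [h3]
  calc _ ≤ Real.exp (2 * l * ζ) / 4 * (l ^ 2 * Real.exp (-(l * Y ε)) * (4 * v)) := by
        gcongr; exact hY ε
    _ = _ := by ring

/-- Herbst's argument: the entropy bound integrates to a bound on the Laplace transform. -/
theorem expect_exp_neg_le (hv : 0 ≤ v) (hζ0 : 0 ≤ ζ)
    (hY : ∀ ε, ∑ i, max (Y ε - Y (flipAt i ε)) 0 ^ 2 ≤ 4 * v)
    (hζ : ∀ ε i, Y ε - Y (flipAt i ε) ≤ 2 * ζ) {l : ℝ} (hl : 0 < l) :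
    𝔼 ε, Real.exp (-(l * Y ε))
      ≤ Real.exp (-(l * 𝔼 ε, Y ε) + l ^ 2 * (v * Real.exp (2 * l * ζ))) := by
  set G : ℝ → ℝ := fun t => 𝔼 ε, Real.exp (-(t * Y ε)) with hG
  have hGpos : ∀ t, 0 < G t := fun t =>
    Finset.expect_pos (fun _ _ => Real.exp_pos _) Finset.univ_nonempty
  have hGd : ∀ t, HasDerivAt G (𝔼 ε, Real.exp (-(t * Y ε)) * (-Y ε)) t := by
    intro t
    simp only [hG, Fintype.expect_eq_sum_div_card]
    refine HasDerivAt.div_const (HasDerivAt.fun_sum fun ε _ => ?_) _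
    have := ((hasDerivAt_id t).mul_const (Y ε)).neg.exp
    simpa using this
  have hLd : ∀ t, HasDerivAt (fun t => Real.log (G t))
      ((𝔼 ε, Real.exp (-(t * Y ε)) * (-Y ε)) / G t) t := fun t => (hGd t).log (hGpos t).ne'
  set C := v * Real.exp (2 * l * ζ) with hC
  -- The derivative of log G(t)/t is the entropy over t²G(t), at most C on (0, l]; hence `u`
  -- decreases from its limit -𝔼 Y at 0.
  set u : ℝ → ℝ := fun t => Real.log (G t) / t - C * t with hu
  have hud : ∀ t, t ≠ 0 → HasDerivAt u
      (((𝔼 ε, Real.exp (-(t * Y ε)) * (-Y ε)) / G t * t - Real.log (G t) * 1) / t ^ 2 - C * 1) t :=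
    fun t ht => ((hLd t).div (hasDerivAt_id t) ht).sub ((hasDerivAt_id t).const_mul C)
  have hanti : AntitoneOn u (Set.Ioc 0 l) := by
    refine antitoneOn_of_deriv_nonpos (convex_Ioc 0 l)
      (fun t ht => (hud t ht.1.ne').continuousAt.continuousWithinAt)
      (fun t ht => ?_) fun t ht => ?_
    · rw [interior_Ioc] at ht
      exact (hud t ht.1.ne').differentiableAt.differentiableWithinAt
    · rw [interior_Ioc] at ht
      rw [(hud t ht.1.ne').deriv]
      have ht0 := ht.1
      have he := entropy_exp_neg_le hY hζ ht0.le
      have hCt : v * Real.exp (2 * t * ζ) ≤ C := by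
        have := ht.2.le
        rw [hC]; gcongr
      have h1 : 𝔼 ε, Real.exp (-(t * Y ε)) * (-(t * Y ε))
          = (𝔼 ε, Real.exp (-(t * Y ε)) * (-Y ε)) * t := by
        rw [Finset.expect_mul]
        exact Finset.expect_congr rfl fun ε _ => by ring
      rw [h1] at he
      change _ - G t * Real.log (G t) ≤ t ^ 2 * _ * G t at he
      have h2 : t ^ 2 * (v * Real.exp (2 * t * ζ)) * G t ≤ t ^ 2 * C * G t := by
        have := hGpos t
        gcongr
      rw [mul_one, mul_one, sub_nonpos, div_le_iff₀ (by positivity), div_mul_eq_mul_div,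
        sub_le_iff_le_add, div_le_iff₀ (hGpos t)]
      linarith
  have hG0 : G 0 = 1 := by simp [hG]
  have hlim : Filter.Tendsto u (nhdsWithin 0 (Set.Ioi 0)) (nhds (-𝔼 ε, Y ε)) := by
    have h1 := (hLd 0).hasDerivWithinAt (s := Set.Ioi 0)
    rw [hasDerivWithinAt_iff_tendsto_slope' (by simp)] at h1
    have h2 : Filter.Tendsto (fun t : ℝ => C * t) (nhdsWithin 0 (Set.Ioi 0)) (nhds (C * 0)) :=
      (Continuous.tendsto (by fun_prop) 0).mono_left nhdsWithin_le_nhds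
    have h3 := h1.sub h2
    have e : (𝔼 ε, Real.exp (-(0 * Y ε)) * (-Y ε)) / G 0 - C * 0 = -𝔼 ε, Y ε := by
      simp [hG0, Finset.expect_neg_distrib]
    rw [e] at h3
    refine h3.congr fun t => ?_
    simp [hu, slope_def_field, hG0]
  have hle : u l ≤ -𝔼 ε, Y ε := by
    refine ge_of_tendsto hlim ?_
    filter_upwards [Ioc_mem_nhdsGT hl] with t ht
    exact hanti ht ⟨hl, le_rfl⟩ ht.2
  have h4 : Real.log (G l) ≤ (-𝔼 ε, Y ε + C * l) * l := by
    rw [← div_le_iff₀ hl]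
    simp only [hu] at hle
    linarith
  rw [← Real.log_le_iff_le_exp (hGpos l)]
  refine h4.trans (le_of_eq ?_)
  ring

/-- Lower tail of a nonnegative function on the cube, tilted at the optimal parameter. -/
theorem exists_chernoff_bound (hv : 0 ≤ v) (hζ0 : 0 ≤ ζ)
    (hY : ∀ ε, ∑ i, max (Y ε - Y (flipAt i ε)) 0 ^ 2 ≤ 4 * v)
    (hζ : ∀ ε i, Y ε - Y (flipAt i ε) ≤ 2 * ζ) {T : ℝ} (hT : 0 < T) (hTY : T ≤ 𝔼 ε, Y ε)
    (hD : 0 < ζ * 𝔼 ε, Y ε + v) :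
    ∃ l, 0 < l ∧ Real.exp (l * (𝔼 ε, Y ε - T)) * 𝔼 ε, Real.exp (-(l * Y ε))
      ≤ Real.exp (-(T ^ 2 / (4 * (ζ * 𝔼 ε, Y ε + v)))) := by
  set R := 𝔼 ε, Y ε
  set D := ζ * R + v with hDdef
  -- The minimizer of -lT + l²D.
  set l := T / (2 * D) with hl
  have hl0 : 0 < l := by positivity
  refine ⟨l, hl0, ?_⟩
  have hmgf := expect_exp_neg_le hv hζ0 hY hζ hl0
  have hr : 2 * l * ζ ≤ ζ * R / D := by
    rw [hl, le_div_iff₀ hD]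
    have : 2 * (T / (2 * D)) * ζ * D = ζ * T := by field_simp
    rw [this]; gcongr
  -- As v = D(1 - ζR/D) ≤ D exp(-ζR/D), the exponential factor cancels; `hr` is where T ≤ R enters.
  have hvK : v * Real.exp (2 * l * ζ) ≤ D := by
    have h1 : v = D * (1 - ζ * R / D) := by field_simp; rw [hDdef]; ring
    have h2 : 1 - ζ * R / D ≤ Real.exp (-(ζ * R / D)) := Real.one_sub_le_exp_neg _
    have h3 : v ≤ D * Real.exp (-(ζ * R / D)) := by
      conv_lhs => rw [h1]
      gcongr
    calc v * Real.exp (2 * l * ζ) ≤ D * Real.exp (-(ζ * R / D)) * Real.exp (ζ * R / D) := by gcongr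
      _ = D := by rw [mul_assoc, ← Real.exp_add]; simp
  calc _ ≤ Real.exp (l * (R - T)) * Real.exp (-(l * R) + l ^ 2 * (v * Real.exp (2 * l * ζ))) := by
        gcongr
    _ = Real.exp (-(l * T) + l ^ 2 * (v * Real.exp (2 * l * ζ))) := by
        rw [← Real.exp_add]; ring_nf
    _ ≤ Real.exp (-(l * T) + l ^ 2 * D) := by gcongr
    _ = _ := by
        congr 1
        rw [hl]; field_simp; ring

end Cube

/-! ### Bounded differences of the MCERA -/

/-- The supremum over the class `F` of the empirical correlation with the weight vector `τ`. -/
noncomputable def supCorr {X : Type*} {m : ℕ} (F : Set (X → ℝ)) (s : Fin m → X)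
    (τ : Fin m → ℝ) : ℝ :=
  ⨆ f : F, (1 / (m : ℝ)) * ∑ i, τ i * (f : X → ℝ) (s i)

/-- The real sign encoded by a Boolean. -/
def boolSign (b : Bool) : ℝ := if b then 1 else -1

theorem boolSign_not (b : Bool) : boolSign (!b) = -boolSign b := by
  cases b <;> simp [boolSign]

theorem abs_boolSign (b : Bool) : |boolSign b| = 1 := by
  cases b <;> simp [boolSign]

section Empirical

variable {X : Type*} {n m : ℕ} {F : Set (X → ℝ)} {s : Fin m → X} {B : ℝ}

theorem abs_le_empSup (hB : ∀ f ∈ F, ∀ x, |f x| ≤ B) {f : X → ℝ} (hf : f ∈ F) (i : Fin m) :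
    |f (s i)| ≤ empSup F s := by
  refine le_ciSup (f := fun p : Fin m × F => |(p.2 : X → ℝ) (s p.1)|) ⟨B, ?_⟩ (i, ⟨f, hf⟩)
  rintro _ ⟨p, rfl⟩
  exact hB _ p.2.2 _

theorem empSup_nonneg : 0 ≤ empSup F s :=
  Real.iSup_nonneg fun _ => abs_nonneg _

theorem empWimpyVar_nonneg : 0 ≤ empWimpyVar F s :=
  mul_nonneg (by positivity)
    (Real.iSup_nonneg fun _ => Finset.sum_nonneg fun _ _ => sq_nonneg _)

theorem sum_sq_le_empWimpyVar (hB : ∀ f ∈ F, ∀ x, |f x| ≤ B) {f : X → ℝ} (hf : f ∈ F) :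
    (1 / (m : ℝ)) * ∑ i, f (s i) ^ 2 ≤ empWimpyVar F s := by
  refine mul_le_mul_of_nonneg_left ?_ (by positivity)
  refine le_ciSup (f := fun f : F => ∑ i, (f : X → ℝ) (s i) ^ 2) ⟨∑ _i : Fin m, B ^ 2, ?_⟩ ⟨f, hf⟩
  rintro _ ⟨g, rfl⟩
  refine Finset.sum_le_sum fun i _ => ?_
  rw [← sq_abs]
  exact pow_le_pow_left₀ (abs_nonneg _) (hB _ g.2 _) 2

theorem empWimpyVar_le_empSup_mul_empAbs (hB : ∀ f ∈ F, ∀ x, |f x| ≤ B) (hF : F.Nonempty) :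
    empWimpyVar F s ≤ empSup F s * empAbs F s := by
  have : Nonempty F := hF.to_subtype
  unfold empWimpyVar empAbs
  rw [mul_left_comm]
  refine mul_le_mul_of_nonneg_left ?_ (by positivity)
  refine ciSup_le fun f => ?_
  have h1 : ∑ i, |(f : X → ℝ) (s i)| ≤ ⨆ f : F, ∑ i, |(f : X → ℝ) (s i)| := by
    refine le_ciSup (f := fun f : F => ∑ i, |(f : X → ℝ) (s i)|) ⟨∑ _i : Fin m, B, ?_⟩ f
    rintro _ ⟨g, rfl⟩
    exact Finset.sum_le_sum fun i _ => hB _ g.2 _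
  refine le_trans ?_ (mul_le_mul_of_nonneg_left h1 empSup_nonneg)
  rw [Finset.mul_sum]
  refine Finset.sum_le_sum fun i _ => ?_
  rw [← sq_abs, sq]
  exact mul_le_mul_of_nonneg_right (abs_le_empSup hB f.2 i) (abs_nonneg _)

theorem corr_le_supCorr (hB : ∀ f ∈ F, ∀ x, |f x| ≤ B) (τ : Fin m → ℝ) {f : X → ℝ} (hf : f ∈ F) :
    (1 / (m : ℝ)) * ∑ i, τ i * f (s i) ≤ supCorr F s τ := by
  refine le_ciSup (f := fun f : F => (1 / (m : ℝ)) * ∑ i, τ i * (f : X → ℝ) (s i))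
    ⟨(1 / (m : ℝ)) * ∑ i : Fin m, |τ i| * B, ?_⟩ ⟨f, hf⟩
  rintro _ ⟨g, rfl⟩
  refine mul_le_mul_of_nonneg_left (Finset.sum_le_sum fun i _ => ?_) (by positivity)
  refine (le_abs_self _).trans ?_
  rw [abs_mul]
  exact mul_le_mul_of_nonneg_left (hB _ g.2 _) (abs_nonneg _)

theorem supCorr_nonneg (hB : ∀ f ∈ F, ∀ x, |f x| ≤ B) (hF0 : (fun _ => 0) ∈ F) (τ : Fin m → ℝ) :
    0 ≤ supCorr F s τ := by
  simpa using corr_le_supCorr (s := s) hB τ hF0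

theorem supCorr_le_empSup (hm : 0 < m) (hB : ∀ f ∈ F, ∀ x, |f x| ≤ B) (hF : F.Nonempty)
    {τ : Fin m → ℝ} (hτ : ∀ i, |τ i| = 1) : supCorr F s τ ≤ empSup F s := by
  have : Nonempty F := hF.to_subtype
  have hm' : (0 : ℝ) < m := by exact_mod_cast hm
  refine ciSup_le fun f => ?_
  have h : ∑ i, τ i * (f : X → ℝ) (s i) ≤ ∑ _i : Fin m, empSup F s := by
    refine Finset.sum_le_sum fun i _ => (le_abs_self _).trans ?_
    rw [abs_mul, hτ, one_mul]
    exact abs_le_empSup hB f.2 i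
  rw [Finset.sum_const, Finset.card_univ, Fintype.card_fin, nsmul_eq_mul] at h
  rw [one_div, inv_mul_le_iff₀ hm']
  exact h

/-- The same f is a competitor after the flip, and its correlation changes only in term i. -/
theorem corr_sub_supCorr_update_le (hB : ∀ f ∈ F, ∀ x, |f x| ≤ B) (τ : Fin m → ℝ) (i : Fin m)
    {f : X → ℝ} (hf : f ∈ F) :
    (1 / (m : ℝ)) * ∑ k, τ k * f (s k) - supCorr F s (Function.update τ i (-τ i))
      ≤ 2 * (τ i * f (s i) / m) := by
  have h := corr_le_supCorr (s := s) hB (Function.update τ i (-τ i)) hf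
  have h2 : ∑ k, Function.update τ i (-τ i) k * f (s k)
      = ∑ k, τ k * f (s k) - 2 * (τ i * f (s i)) := by
    rw [← Finset.add_sum_erase _ _ (Finset.mem_univ i),
      ← Finset.add_sum_erase _ (fun k => τ k * f (s k)) (Finset.mem_univ i)]
    rw [Finset.sum_congr rfl fun k hk => by
      rw [Function.update_of_ne (Finset.ne_of_mem_erase hk)]]
    rw [Function.update_self]
    ring
  rw [h2] at h
  have h3 : (1 / (m : ℝ)) * (∑ k, τ k * f (s k) - 2 * (τ i * f (s i)))
      = (1 / (m : ℝ)) * ∑ k, τ k * f (s k) - 2 * (τ i * f (s i) / m) := by ring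
  linarith

theorem supCorr_sub_supCorr_update_le (hB : ∀ f ∈ F, ∀ x, |f x| ≤ B) (hF : F.Nonempty)
    {τ : Fin m → ℝ} (hτ : ∀ i, |τ i| = 1) (i : Fin m) :
    supCorr F s τ - supCorr F s (Function.update τ i (-τ i)) ≤ 2 * (empSup F s / m) := by
  have : Nonempty F := hF.to_subtype
  rw [sub_le_iff_le_add]
  refine ciSup_le fun f => ?_
  rw [← sub_le_iff_le_add]
  refine (corr_sub_supCorr_update_le hB τ i f.2).trans ?_
  gcongr
  refine (le_abs_self _).trans ?_
  rw [abs_mul, hτ, one_mul]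
  exact abs_le_empSup hB f.2 i

theorem sum_max_supCorr_sub_sq_le (hB : ∀ f ∈ F, ∀ x, |f x| ≤ B) (hF : F.Nonempty)
    {τ : Fin m → ℝ} (hτ : ∀ i, |τ i| = 1) :
    ∑ i, max (supCorr F s τ - supCorr F s (Function.update τ i (-τ i))) 0 ^ 2
      ≤ 4 * (empWimpyVar F s / m) := by
  have : Nonempty F := hF.to_subtype
  set d : Fin m → ℝ := fun i =>
    max (supCorr F s τ - supCorr F s (Function.update τ i (-τ i))) 0 with hd
  have hd0 : ∀ i, 0 ≤ d i := fun i => le_max_right _ _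
  -- The supremum need not be attained, so an η-optimal f serves all i at once, and η → 0 at the
  -- end.
  have key : ∀ η > 0, ∑ i, d i ^ 2 ≤ 4 * (empWimpyVar F s / m) + η * (2 * ∑ i, d i) := by
    intro η hη
    obtain ⟨f, hf⟩ := exists_lt_of_lt_ciSup (show supCorr F s τ - η < supCorr F s τ by linarith)
    have hdi : ∀ i, d i ^ 2 ≤ d i ^ 2 / 2 + 2 * ((f : X → ℝ) (s i) / m) ^ 2 + η * d i := by
      intro i
      have h1 := corr_sub_supCorr_update_le (s := s) hB τ i f.2
      have h2 : d i * d i ≤ d i * (2 * (τ i * (f : X → ℝ) (s i) / m) + η) := by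
        rcases max_choice (supCorr F s τ - supCorr F s (Function.update τ i (-τ i))) 0 with h | h
        · refine mul_le_mul_of_nonneg_left ?_ (hd0 i)
          simp only [hd, h]
          linarith
        · have : d i = 0 := h
          simp [this]
      have h3 : (τ i * (f : X → ℝ) (s i) / m) ^ 2 = ((f : X → ℝ) (s i) / m) ^ 2 := by
        rw [mul_div_assoc, mul_pow, ← sq_abs (τ i), hτ]; ring
      nlinarith [sq_nonneg (d i - 2 * (τ i * (f : X → ℝ) (s i) / m))]
    have hsum := Finset.sum_le_sum fun i (_ : i ∈ Finset.univ) => hdi i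
    rw [Finset.sum_add_distrib, Finset.sum_add_distrib, ← Finset.sum_div, ← Finset.mul_sum,
      ← Finset.mul_sum] at hsum
    have hw : ∑ i, ((f : X → ℝ) (s i) / m) ^ 2 ≤ empWimpyVar F s / m := by
      have := div_le_div_of_nonneg_right (sum_sq_le_empWimpyVar (s := s) hB f.2) (Nat.cast_nonneg m)
      refine le_trans (le_of_eq ?_) this
      rw [Finset.mul_sum, Finset.sum_div]
      refine Finset.sum_congr rfl fun i _ => ?_
      ring
    linarith
  have hlim : Filter.Tendsto (fun η : ℝ => 4 * (empWimpyVar F s / m) + η * (2 * ∑ i, d i))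
      (nhdsWithin 0 (Set.Ioi 0)) (nhds (4 * (empWimpyVar F s / m) + 0 * (2 * ∑ i, d i))) :=
    (Continuous.tendsto (by fun_prop) 0).mono_left nhdsWithin_le_nhds
  rw [zero_mul, add_zero] at hlim
  exact ge_of_tendsto hlim (by filter_upwards [self_mem_nhdsWithin] with η hη using key η hη)

theorem mcera_eq (σ : Fin n → Fin m → ℝ) :
    mcera F s σ = (1 / (n : ℝ)) * ∑ j, supCorr F s (σ j) := rfl

theorem mcera_nonneg (hB : ∀ f ∈ F, ∀ x, |f x| ≤ B) (hF0 : (fun _ => 0) ∈ F)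
    (σ : Fin n → Fin m → ℝ) : 0 ≤ mcera F s σ :=
  mul_nonneg (by positivity) (Finset.sum_nonneg fun _ _ => supCorr_nonneg hB hF0 _)

theorem mcera_le_empSup (hn : 0 < n) (hm : 0 < m) (hB : ∀ f ∈ F, ∀ x, |f x| ≤ B)
    (hF : F.Nonempty) {σ : Fin n → Fin m → ℝ} (hσ : ∀ j i, |σ j i| = 1) :
    mcera F s σ ≤ empSup F s := by
  have hn' : (0 : ℝ) < n := by exact_mod_cast hn
  have h : ∑ j, supCorr F s (σ j) ≤ ∑ _j : Fin n, empSup F s :=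
    Finset.sum_le_sum fun j _ => supCorr_le_empSup hm hB hF (hσ j)
  rw [Finset.sum_const, Finset.card_univ, Fintype.card_fin, nsmul_eq_mul] at h
  rw [mcera_eq, one_div, inv_mul_le_iff₀ hn']
  exact h

theorem mcera_sub_mcera_flipAt (ε : Fin n × Fin m → Bool) (p : Fin n × Fin m) :
    mcera F s (fun j i => boolSign (ε (j, i)))
        - mcera F s (fun j i => boolSign (flipAt p ε (j, i)))
      = (1 / (n : ℝ)) * (supCorr F s (fun i => boolSign (ε (p.1, i)))
        - supCorr F s (Function.update (fun i => boolSign (ε (p.1, i))) p.2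
          (-boolSign (ε (p.1, p.2))))) := by
  rw [mcera_eq, mcera_eq, ← mul_sub, ← Finset.sum_sub_distrib]
  congr 1
  rw [Finset.sum_eq_single p.1]
  · congr 2
    funext i
    by_cases hi : i = p.2
    · subst hi; simp [flipAt, boolSign_not]
    · have : (p.1, i) ≠ p := fun h => hi (by rw [← h])
      simp [flipAt, this, hi]
  · intro j _ hj
    have : ∀ i, (j, i) ≠ p := fun i h => hj (by rw [← h])
    simp [flipAt, this]
  · simp

theorem mcera_sub_mcera_flipAt_le (hB : ∀ f ∈ F, ∀ x, |f x| ≤ B) (hF : F.Nonempty)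
    (ε : Fin n × Fin m → Bool) (p : Fin n × Fin m) :
    mcera F s (fun j i => boolSign (ε (j, i)))
        - mcera F s (fun j i => boolSign (flipAt p ε (j, i)))
      ≤ 2 * (empSup F s / (n * m)) := by
  rw [mcera_sub_mcera_flipAt]
  have := supCorr_sub_supCorr_update_le (s := s) hB hF
    (τ := fun i => boolSign (ε (p.1, i))) (fun _ => abs_boolSign _) p.2
  calc _ ≤ (1 / (n : ℝ)) * (2 * (empSup F s / m)) := by gcongr
    _ = _ := by rw [← div_div, div_right_comm]; ring

/-- A flip alters one row, with weight 1/n: squares gain 1/n² and the n rows leave 1/n. -/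
theorem sum_max_mcera_sub_sq_le (hn : 0 < n) (hB : ∀ f ∈ F, ∀ x, |f x| ≤ B) (hF : F.Nonempty)
    (ε : Fin n × Fin m → Bool) :
    ∑ p, max (mcera F s (fun j i => boolSign (ε (j, i)))
        - mcera F s (fun j i => boolSign (flipAt p ε (j, i)))) 0 ^ 2
      ≤ 4 * (empWimpyVar F s / (n * m)) := by
  have hn' : (n : ℝ) ≠ 0 := by exact_mod_cast hn.ne'
  have hmax : ∀ x : ℝ, max (1 / (n : ℝ) * x) 0 ^ 2 = (1 / (n : ℝ)) ^ 2 * max x 0 ^ 2 := by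
    intro x
    rw [← mul_pow, mul_max_of_nonneg _ _ (by positivity), mul_zero]
  simp only [mcera_sub_mcera_flipAt, hmax]
  rw [← Finset.mul_sum, Fintype.sum_prod_type]
  have h : ∀ j : Fin n, ∑ i, max (supCorr F s (fun i => boolSign (ε (j, i)))
        - supCorr F s (Function.update (fun i => boolSign (ε (j, i))) i
          (-boolSign (ε (j, i))))) 0 ^ 2 ≤ 4 * (empWimpyVar F s / m) := fun j =>
    sum_max_supCorr_sub_sq_le hB hF fun _ => abs_boolSign _
  calc _ ≤ (1 / (n : ℝ)) ^ 2 * ∑ _j : Fin n, 4 * (empWimpyVar F s / m) := by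
        gcongr with j; exact h j
    _ = _ := by
        rw [Finset.sum_const, Finset.card_univ, Fintype.card_fin, nsmul_eq_mul]
        rw [mul_comm (n : ℝ) m, ← div_div]
        field_simp

end Empirical

/-! ### From random signs to the uniform cube -/

namespace IsRademacherMatrix

variable {Ω : Type*} [MeasurableSpace Ω] {P : Measure Ω} {n m : ℕ}
  {σ : Fin n → Fin m → Ω → ℝ}

/-- The Boolean encoding of a random sign matrix. -/
noncomputable def signs (σ : Fin n → Fin m → Ω → ℝ) (ω : Ω) : Fin n × Fin m → Bool :=
  fun p => @decide (σ p.1 p.2 ω = 1) (Classical.propDecidable _)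

theorem measurable_signs (hσ : IsRademacherMatrix σ P) : Measurable (signs σ) := by
  refine measurable_pi_lambda _ fun p => measurable_to_bool ?_
  have : (fun ω => signs σ ω p) ⁻¹' {true} = (σ p.1 p.2) ⁻¹' {1} := by
    ext ω; simp [signs]
  rw [this]
  exact hσ.measurable _ _ (measurableSet_singleton _)

theorem ae_eq_signs [IsProbabilityMeasure P] (hσ : IsRademacherMatrix σ P) :
    ∀ᵐ ω ∂P, (fun j i => σ j i ω) = fun j i => boolSign (signs σ ω (j, i)) := by
  have h : ∀ j i, ∀ᵐ ω ∂P, σ j i ω = 1 ∨ σ j i ω = -1 := by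
    intro j i
    have m1 : MeasurableSet {ω | σ j i ω = 1} := hσ.measurable j i (measurableSet_singleton 1)
    have m2 : MeasurableSet {ω | σ j i ω = -1} := hσ.measurable j i (measurableSet_singleton (-1))
    have hd : Disjoint {ω | σ j i ω = 1} {ω | σ j i ω = -1} := by
      rw [Set.disjoint_left]
      intro ω h1 h2
      simp only [Set.mem_ofPred_eq] at h1 h2
      linarith
    have hu : P ({ω | σ j i ω = 1} ∪ {ω | σ j i ω = -1}) = 1 := by
      rw [measure_union hd m2, hσ.prob_one, hσ.prob_neg_one, ENNReal.add_halves]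
    exact (mem_ae_iff_prob_eq_one (m1.union m2)).2 hu
  have h' : ∀ᵐ ω ∂P, ∀ j i, σ j i ω = 1 ∨ σ j i ω = -1 :=
    ae_all_iff.2 fun j => ae_all_iff.2 fun i => h j i
  filter_upwards [h'] with ω hω
  funext j i
  rcases hω j i with h | h
  · simp [signs, boolSign, h]
  · rw [h]; norm_num [signs, boolSign, h]

theorem map_signs_singleton [IsProbabilityMeasure P] (hσ : IsRademacherMatrix σ P)
    (ε : Fin n × Fin m → Bool) :
    (P.map (signs σ)).real {ε} = (Fintype.card (Fin n × Fin m → Bool) : ℝ)⁻¹ := by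
  have h1 : P (signs σ ⁻¹' {ε})
      = P (⋂ p ∈ (Finset.univ : Finset (Fin n × Fin m)),
          (fun ω => σ p.1 p.2 ω) ⁻¹' {boolSign (ε p)}) := by
    refine measure_congr (Filter.eventuallyEq_set.2 ?_)
    filter_upwards [hσ.ae_eq_signs] with ω hω
    have hω' : ∀ p : Fin n × Fin m, σ p.1 p.2 ω = boolSign (signs σ ω p) := fun p =>
      congrFun (congrFun hω p.1) p.2
    have hinj : ∀ x y : Bool, boolSign x = boolSign y ↔ x = y := by
      intro x y
      cases x <;> cases y <;> norm_num [boolSign]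
    simp [hω', hinj, funext_iff]
  have h2 := hσ.indep.measure_inter_preimage_eq_mul (S := Finset.univ)
    (sets := fun p => {boolSign (ε p)}) fun p _ => measurableSet_singleton _
  have h3 : ∀ p : Fin n × Fin m, P ((fun ω => σ p.1 p.2 ω) ⁻¹' {boolSign (ε p)}) = 1 / 2 := by
    intro p
    cases hp : ε p
    · exact hσ.prob_neg_one p.1 p.2
    · exact hσ.prob_one p.1 p.2
  rw [measureReal_def, Measure.map_apply hσ.measurable_signs (measurableSet_singleton _), h1, h2]
  simp [h3]

theorem integral_comp_signs [IsProbabilityMeasure P] (hσ : IsRademacherMatrix σ P)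
    (f : (Fin n × Fin m → Bool) → ℝ) :
    ∫ ω, f (signs σ ω) ∂P = 𝔼 ε, f ε := by
  have : IsProbabilityMeasure (P.map (signs σ)) :=
    Measure.isProbabilityMeasure_map hσ.measurable_signs.aemeasurable
  rw [← integral_map hσ.measurable_signs.aemeasurable
    (measurable_of_finite f).aestronglyMeasurable, integral_fintype .of_finite]
  simp only [hσ.map_signs_singleton, smul_eq_mul]
  rw [← Finset.mul_sum, Fintype.expect_eq_sum_div_card, div_eq_inv_mul]

end IsRademacherMatrix

/-! ### Deviation bound and its inversion -/

theorem le_add_sqrt_of_sq_sub_le {R r c d : ℝ}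
    (h : (R - r) ^ 2 ≤ 4 * (c * R + d)) :
    R ≤ r + 2 * c + √((2 * c) ^ 2 + 4 * (c * r + d)) := by
  -- Completing the square in R, centred at r + 2c.
  have := Real.le_sqrt_of_sq_le (x := R - r - 2 * c) (y := (2 * c) ^ 2 + 4 * (c * r + d))
    (by nlinarith)
  linarith

/-- Lower tail of the Monte Carlo average in terms of the wimpy variance. -/
theorem measureReal_mcera_lt_le {X Ω : Type*} [MeasurableSpace Ω] {P : Measure Ω}
    [IsProbabilityMeasure P] {n m : ℕ} (hn : 0 < n) (hm : 0 < m) {B : ℝ} {F : Set (X → ℝ)}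
    (hB : ∀ f ∈ F, ∀ x, |f x| ≤ B) (hF0 : (fun _ => 0) ∈ F) (s : Fin m → X)
    {σ : Fin n → Fin m → Ω → ℝ} (hσ : IsRademacherMatrix σ P) {δ : ℝ} (hδ : 0 < δ) (hδ1 : δ ≤ 1) :
    P.real {ω | mcera F s (fun j i => σ j i ω) < era F s σ P
      - √(4 * (empSup F s / (n * m) * era F s σ P + empWimpyVar F s / (n * m))
          * Real.log (1 / δ))} ≤ δ := by
  set Y : (Fin n × Fin m → Bool) → ℝ := fun ε => mcera F s fun j i => boolSign (ε (j, i))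
  have hF : F.Nonempty := ⟨_, hF0⟩
  have hY0 : ∀ ε, 0 ≤ Y ε := fun ε => mcera_nonneg hB hF0 _
  have hYz : ∀ ε, Y ε ≤ empSup F s := fun ε => mcera_le_empSup hn hm hB hF fun _ _ => abs_boolSign _
  have hn' : (0 : ℝ) < n := by exact_mod_cast hn
  have hm' : (0 : ℝ) < m := by exact_mod_cast hm
  have hae : ∀ᵐ ω ∂P, mcera F s (fun j i => σ j i ω) = Y (IsRademacherMatrix.signs σ ω) := by
    filter_upwards [hσ.ae_eq_signs] with ω hω
    rw [hω]
  have hera : era F s σ P = 𝔼 ε, Y ε := by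
    rw [era, integral_congr_ae hae, hσ.integral_comp_signs Y]
  rw [hera]
  set R := 𝔼 ε, Y ε
  set ζ := empSup F s / (n * m)
  set v := empWimpyVar F s / (n * m)
  have hz0 : 0 ≤ empSup F s := empSup_nonneg
  have hζ0 : 0 ≤ ζ := by positivity
  have hv0 : 0 ≤ v := div_nonneg empWimpyVar_nonneg (by positivity)
  set L := Real.log (1 / δ) with hL
  have hL0 : 0 ≤ L := Real.log_nonneg (by rw [le_div_iff₀ hδ]; linarith)
  set T := √(4 * (ζ * R + v) * L) with hT
  have hset : P.real {ω | mcera F s (fun j i => σ j i ω) < R - T}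
      = P.real {ω | Y (IsRademacherMatrix.signs σ ω) < R - T} := by
    refine measureReal_congr (Filter.eventuallyEq_set.2 ?_)
    filter_upwards [hae] with ω hω
    rw [hω]
  rw [hset]
  -- The degenerate cases go first (T > R, δ = 1, R = 0), leaving 0 < T ≤ R and ζ > 0 for the
  -- Chernoff bound.
  rcases lt_or_ge (R - T) 0 with hneg | hTR
  · have : {ω | Y (IsRademacherMatrix.signs σ ω) < R - T} = ∅ := by
      ext ω
      simpa using hneg.le.trans (hY0 _)
    rw [this]; simpa using hδ.le
  rcases eq_or_lt_of_le hδ1 with rfl | hδlt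
  · exact measureReal_le_one
  have hLpos : 0 < L := Real.log_pos (by rw [lt_div_iff₀ hδ]; linarith)
  have hR0 : 0 ≤ R := (Real.sqrt_nonneg _).trans (by linarith : T ≤ R)
  rcases hR0.eq_or_lt with hRz | hRpos
  · have : {ω | Y (IsRademacherMatrix.signs σ ω) < R - T} = ∅ := by
      ext ω
      have h1 : R - T ≤ 0 := by have : 0 ≤ T := Real.sqrt_nonneg _; linarith
      simpa using h1.trans (hY0 _)
    rw [this]; simpa using hδ.le
  have hzpos : 0 < empSup F s := hRpos.trans_le <|
    Finset.expect_le Finset.univ_nonempty fun ε _ => hYz ε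
  have hζpos : 0 < ζ := by positivity
  have hD : 0 < ζ * R + v := by positivity
  have hTpos : 0 < T := Real.sqrt_pos.2 (by positivity)
  obtain ⟨l, hl, hbound⟩ := exists_chernoff_bound (Y := Y) hv0 hζ0
    (sum_max_mcera_sub_sq_le hn hB hF) (mcera_sub_mcera_flipAt_le hB hF) hTpos
    (by linarith) hD
  have hexp : Real.exp (-(T ^ 2 / (4 * (ζ * R + v)))) = δ := by
    rw [hT, Real.sq_sqrt (by positivity), mul_div_cancel_left₀ _ (by positivity), hL, one_div,
      Real.log_inv, neg_neg, Real.exp_log hδ]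
  have hint : Integrable (fun ω => Real.exp (-l * Y (IsRademacherMatrix.signs σ ω))) P := by
    have : IsProbabilityMeasure (P.map (IsRademacherMatrix.signs σ)) :=
      Measure.isProbabilityMeasure_map hσ.measurable_signs.aemeasurable
    exact (Integrable.of_finite (f := fun ε => Real.exp (-l * Y ε))).comp_measurable
      hσ.measurable_signs
  have hch := measure_le_le_exp_mul_mgf (μ := P)
    (X := fun ω => Y (IsRademacherMatrix.signs σ ω)) (t := -l) (R - T) (by linarith) hint
  have hmgf : mgf (fun ω => Y (IsRademacherMatrix.signs σ ω)) P (-l)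
      = 𝔼 ε, Real.exp (-(l * Y ε)) := by
    rw [mgf, hσ.integral_comp_signs fun ε => Real.exp (-l * Y ε)]
    simp only [neg_mul]
  rw [hmgf, neg_neg] at hch
  calc _ ≤ P.real {ω | Y (IsRademacherMatrix.signs σ ω) ≤ R - T} :=
        measureReal_mono (Set.ofPred_subset_ofPred.2 fun ω hω => le_of_lt hω)
    _ ≤ _ := hch
    _ ≤ _ := hbound
    _ = δ := hexp

theorem mainTheorem3 {X Ω : Type*} [MeasurableSpace Ω] (P : Measure Ω) [IsProbabilityMeasure P]
    (n m : ℕ) (hn : 0 < n) (hm : 0 < m)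
    (a b : ℝ) (ha : a ≤ 0) (hb : 0 < b)
    (F : Set (X → ℝ)) (hF : ∀ f ∈ F, ∀ x, f x ∈ Set.Icc a b) (hF0 : (fun _ => 0) ∈ F)
    (s : Fin m → X)
    (σ : Fin n → Fin m → Ω → ℝ) (hσ : IsRademacherMatrix σ P)
    (δ : ℝ) (hδ : 0 < δ) (hδ1 : δ ≤ 1) :
    (1 - δ ≤ P.real {ω | era F s σ P ≤
        mcera F s (fun j i => σ j i ω)
        + 2 * empSup F s * Real.log (1 / δ) / (n * m)
        + √((2 * empSup F s * Real.log (1 / δ) / (n * m)) ^ 2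
            + 4 * empSup F s * (mcera F s (fun j i => σ j i ω) + empAbs F s)
                * Real.log (1 / δ) / (n * m))}) ∧
    (1 - δ ≤ P.real {ω | era F s σ P ≤
        mcera F s (fun j i => σ j i ω)
        + 2 * empSup F s * Real.log (1 / δ) / (n * m)
        + √((2 * empSup F s * Real.log (1 / δ) / (n * m)) ^ 2
            + 4 * (empSup F s * mcera F s (fun j i => σ j i ω) + empWimpyVar F s)
                * Real.log (1 / δ) / (n * m))}) := by
  have hB : ∀ f ∈ F, ∀ x, |f x| ≤ b - a := fun f hf x => by
    have := hF f hf x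
    rw [abs_le]
    constructor <;> linarith [this.1, this.2]
  have hL0 : 0 ≤ Real.log (1 / δ) := Real.log_nonneg (by rw [le_div_iff₀ hδ]; linarith)
  have hz0 : 0 ≤ empSup F s := empSup_nonneg
  have hmain := measureReal_mcera_lt_le hn hm hB hF0 s hσ hδ hδ1
  have hwimpy : 1 - δ ≤ P.real {ω | era F s σ P ≤
        mcera F s (fun j i => σ j i ω)
        + 2 * empSup F s * Real.log (1 / δ) / (n * m)
        + √((2 * empSup F s * Real.log (1 / δ) / (n * m)) ^ 2
            + 4 * (empSup F s * mcera F s (fun j i => σ j i ω) + empWimpyVar F s)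
                * Real.log (1 / δ) / (n * m))} := by
    set S := {ω | era F s σ P ≤
        mcera F s (fun j i => σ j i ω)
        + 2 * empSup F s * Real.log (1 / δ) / (n * m)
        + √((2 * empSup F s * Real.log (1 / δ) / (n * m)) ^ 2
            + 4 * (empSup F s * mcera F s (fun j i => σ j i ω) + empWimpyVar F s)
                * Real.log (1 / δ) / (n * m))}
    -- Subadditivity suffices, so measurability of `S` is not needed.
    have hcover : (1 : ℝ) ≤ P.real S + P.real Sᶜ := by
      have h := measureReal_union_le (μ := P) S Sᶜ
      rwa [Set.union_compl_self, probReal_univ] at h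
    have hbad : P.real Sᶜ ≤ δ := by
      refine le_trans (measureReal_mono fun ω hω => ?_) hmain
      by_contra hcon
      refine hω ?_
      simp only [Set.mem_ofPred_eq, not_lt] at hcon
      set r := mcera F s (fun j i => σ j i ω)
      set R := era F s σ P
      have key : R ≤ r + 2 * (empSup F s * Real.log (1 / δ) / (n * m))
          + √((2 * (empSup F s * Real.log (1 / δ) / (n * m))) ^ 2
            + 4 * (empSup F s * Real.log (1 / δ) / (n * m) * r
              + empWimpyVar F s * Real.log (1 / δ) / (n * m))) := by
        rcases le_total R r with hRr | hRr
        · have : 0 ≤ 2 * (empSup F s * Real.log (1 / δ) / (n * m)) := by positivity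
          have := Real.sqrt_nonneg ((2 * (empSup F s * Real.log (1 / δ) / (n * m))) ^ 2
            + 4 * (empSup F s * Real.log (1 / δ) / (n * m) * r
              + empWimpyVar F s * Real.log (1 / δ) / (n * m)))
          linarith
        · refine le_add_sqrt_of_sq_sub_le ?_
          have hR0 : 0 ≤ R := (mcera_nonneg hB hF0 _).trans hRr
          have hw0 : 0 ≤ empWimpyVar F s := empWimpyVar_nonneg
          have h1 := pow_le_pow_left₀ (sub_nonneg.2 hRr) (sub_le_comm.1 hcon) 2
          rw [Real.sq_sqrt (by positivity)] at h1
          refine h1.trans (le_of_eq ?_)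
          ring
      change R ≤ _
      convert key using 3
      · ring
      · congr 1 <;> ring
    linarith
  refine ⟨hwimpy.trans (measureReal_mono
    (Set.ofPred_subset_ofPred.2 fun ω hω => hω.trans ?_)), hwimpy⟩
  gcongr _ + √(_ + ?_)
  -- The ν̂ bound is weaker than the σ̂² bound, since f² ≤ ẑ|f| on the sample.
  have hw := empWimpyVar_le_empSup_mul_empAbs (s := s) hB ⟨_, hF0⟩
  rw [mul_assoc 4 (empSup F s)]
  gcongr
  rw [mul_add]
  gcongr
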